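/- Let $G$ be a countable discrete group that is amenable, i.e. there are finite sets $e\in F_1\subset F_2\subset\cdots\subset G$ with $\bigcup_n F_n=G$ and $\lim_{n\to\infty}|F_n\triangle F_ns|/|F_n|=0$ for all $s\in G$, and maximally almost periodic, i.e. the finite dimensional unitary representations of $G$ separate the points of $G$. Let $C^*(G)$ be the full group C*-algebra of $G$, the C*-algebra generated by the image of the universal unitary representation of $G$ (the direct sum of all unitary representations). Then $C^*(G)$ is quasidiagonal: there are a faithful (injective) $*$-representation $\pi$ of $C^*(G)$ on a separable Hilbert space $\mathcal H$ and a sequence of finite rank orthogonal projections $P_n\in\mathcal B(\mathcal H)$ such that $P_n\to I_{\mathcal H}$ strongly and $\|[T,P_n]\|\to0$ for all $T$ in a subset of $\pi(C^*(G))$ whose linear span is dense in $\pi(C^*(G))$; moreover $\pi(C^*(G))$ is norm separable. -/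

import Mathlib

open Filter Topology
open scoped ENNReal

universe u

noncomputable section

/-- Amenability of a (discrete, countable) group: there is an increasing sequence
`1 ∈ F 0 ⊆ F 1 ⊆ ⋯` of finite subsets exhausting the group with
`|F n ∆ (F n) s| / |F n| → 0` for every `s` (a sequence of right Følner sets). -/
def IsAmenableGroup (G : Type*) [Group G] : Prop :=
  open scoped Classical in
  ∃ F : ℕ → Finset G, 1 ∈ F 0 ∧ Monotone F ∧ (∀ g : G, ∃ n, g ∈ F n) ∧
    ∀ s : G, Tendsto
      (fun n => ((symmDiff (F n) ((F n).image (fun x => x * s))).card : ℝ) / ((F n).card : ℝ))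
      atTop (𝓝 0)

/-- A group is maximally almost periodic if its finite-dimensional unitary
representations separate its points. -/
def IsMaximallyAlmostPeriodic (G : Type*) [Group G] : Prop :=
  ∀ g h : G, g ≠ h → ∃ (n : ℕ) (π : G →* Matrix.unitaryGroup (Fin n) ℂ), π g ≠ π h

/-- A unitary representation of the discrete group `G` on a nonzero complex Hilbert space. -/
structure UnitaryRep (G : Type u) [Group G] : Type (u + 1) where
  /-- the Hilbert space of the representation -/
  H : Type u
  [normedAddCommGroup : NormedAddCommGroup H]
  [innerProductSpace : InnerProductSpace ℂ H]
  [completeSpace : CompleteSpace H]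
  [nontrivial : Nontrivial H]
  /-- the representation -/
  ρ : G →* unitary (H →L[ℂ] H)

attribute [instance] UnitaryRep.normedAddCommGroup UnitaryRep.innerProductSpace
  UnitaryRep.completeSpace UnitaryRep.nontrivial

/-- The C⋆-algebra of all bounded families `(T_i)` with `T_i ∈ B(H_i)`, where `i` runs over all
unitary representations of `G`; these are the block-diagonal operators on `⨁ H_i`, the Hilbert
space of the universal representation, and the norm is the supremum of the norms of the blocks. -/
abbrev UniversalOperators (G : Type u) [Group G] : Type (u + 1) :=
  lp (fun i : UnitaryRep G => i.H →L[ℂ] i.H) ∞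

instance UniversalOperators.instCStarAlgebra (G : Type u) [Group G] :
    CStarAlgebra (UniversalOperators G) where

/-- The universal representation `s ↦ ⨁ ρ_i(s)` of `G`, the direct sum of all unitary
representations. -/
def universalRep (G : Type u) [Group G] (s : G) : UniversalOperators G :=
  ⟨fun i => (i.ρ s : i.H →L[ℂ] i.H), memℓp_infty
    ⟨1, by rintro _ ⟨i, rfl⟩; exact (CStarRing.norm_coe_unitary (i.ρ s)).le⟩⟩

/-- The full group C⋆-algebra `C⋆(G)`: the C⋆-algebra generated by the image of the universal
representation. -/
def groupCStarSubalgebra (G : Type u) [Group G] : StarSubalgebra ℂ (UniversalOperators G) :=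
  (StarAlgebra.adjoin ℂ (Set.range (universalRep G))).topologicalClosure

/-- The full group C⋆-algebra `C⋆(G)` as a type. -/
abbrev GroupCStarAlgebra (G : Type u) [Group G] : Type (u + 1) := groupCStarSubalgebra G

instance GroupCStarAlgebra.instCStarAlgebra (G : Type u) [Group G] :
    CStarAlgebra (GroupCStarAlgebra G) :=
  StarSubalgebra.cstarAlgebra _ (h_closed := StarSubalgebra.isClosed_topologicalClosure _)

section Quasidiagonal

variable {H : Type*} [NormedAddCommGroup H] [InnerProductSpace ℂ H] [CompleteSpace H]

/-- `P` is a sequence of finite rank orthogonal projections converging strongly to the identity. -/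
def IsApproximatingProjections (P : ℕ → (H →L[ℂ] H)) : Prop :=
  (∀ n, IsStarProjection (P n)) ∧
  (∀ n, FiniteDimensional ℂ (LinearMap.range (P n : H →ₗ[ℂ] H))) ∧
  (∀ x : H, Tendsto (fun n => P n x) atTop (𝓝 x))

/-- A set `S` of operators is quasidiagonal if it is norm separable and there is one sequence
`(P n)` of finite rank projections converging strongly to the identity such that
`‖[T, P n]‖ → 0` for all `T` in a subset `D` of `S` whose linear span is dense in `S`. -/
def IsQuasidiagonalSet (S : Set (H →L[ℂ] H)) : Prop :=
  TopologicalSpace.IsSeparable S ∧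
  ∃ P : ℕ → (H →L[ℂ] H), IsApproximatingProjections P ∧
    ∃ D : Set (H →L[ℂ] H), D ⊆ S ∧ S ⊆ closure (Submodule.span ℂ D : Set (H →L[ℂ] H)) ∧
      ∀ T ∈ D, Tendsto (fun n => ‖T * P n - P n * T‖) atTop (𝓝 0)

end Quasidiagonal

/-- A unital C⋆-algebra `A` is quasidiagonal if it has a faithful (i.e. injective) unital
⋆-representation on a separable Hilbert space whose image is a quasidiagonal set of operators.
(Separable Hilbert spaces have isometric copies in every universe, so `H : Type` is no
restriction.) -/
def IsQuasidiagonalCStarAlgebra (A : Type*) [CStarAlgebra A] : Prop :=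
  ∃ (H : Type) (_ : NormedAddCommGroup H) (_ : InnerProductSpace ℂ H) (_ : CompleteSpace H)
    (_ : TopologicalSpace.SeparableSpace H) (π : A →⋆ₐ[ℂ] (H →L[ℂ] H)),
    Function.Injective π ∧ IsQuasidiagonalSet (Set.range π)

end

/-! Countably many finite-dimensional representations `σ k` already compute the norm of $C^*(G)$.
Their direct sum is then faithful and block diagonal, so it commutes with the cutoffs to finitely
many blocks, and quasidiagonality holds with zero commutators.

Maximal almost periodicity supplies `σ k`. If $\pi(g)\ne1$, the normalized character of $\pi\oplus1$
has modulus below 1 at $g$; tensor products handle finite sets and tensor powers make the values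
small, so the characters tend to $\delta_1$ pointwise (`exists_seq_tendsto_char`).

Amenability supplies the norm bound (`norm_sum_smul_le_of_tendsto_char`). Let $T=\sum
c_a\sigma_k(a)$ have norm at most $C$ for all $k$, and apply $T\otimes1$ to $\sum_{s\in
F}\sigma_k(s^{-1})e_j\otimes\rho(s)\xi$. Averaging over the basis $(e_j)$ produces characters, and
$k\to\infty$ replaces them by $\delta_1$. What remains bounds $\sum\bar c_ac_b\,|F\cap
F(a^{-1}b)^{-1}|\,\langle\xi,\rho(a^{-1}b)\xi\rangle$ by $C^2|F|\,\|\xi\|^2$. Dividing by $|F|$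
along a Følner sequence gives $\|\sum c_a\rho(a)\xi\|\le C\|\xi\|$. -/

/-! ### Normalized characters of finite-dimensional representations. -/

section Characters

open scoped Kronecker Matrix

/-- A finite-dimensional unitary matrix representation of a group. -/
structure MatrixRep (G : Type*) [Group G] where
  /-- the index set of the matrices -/
  ι : Type
  [fintype : Fintype ι]
  [decidableEq : DecidableEq ι]
  [nonempty : Nonempty ι]
  /-- the representation -/
  π : G →* Matrix.unitaryGroup ι ℂ

attribute [instance] MatrixRep.fintype MatrixRep.decidableEq MatrixRep.nonempty

namespace MatrixRep

variable {G : Type*} [Group G]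

/-- The normalized character of a matrix representation. -/
noncomputable def char (σ : MatrixRep G) (g : G) : ℂ :=
  (σ.π g : Matrix σ.ι σ.ι ℂ).trace / Fintype.card σ.ι

theorem card_pos (σ : MatrixRep G) : (0 : ℝ) < Fintype.card σ.ι :=
  Nat.cast_pos.2 Fintype.card_pos

theorem char_one (σ : MatrixRep G) : σ.char 1 = 1 := by
  simp [char]

theorem norm_trace_le {ι : Type*} [Fintype ι] [DecidableEq ι] (U : Matrix.unitaryGroup ι ℂ) :
    ‖(U : Matrix ι ι ℂ).trace‖ ≤ Fintype.card ι := by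
  refine (norm_sum_le _ _).trans ?_
  refine (Finset.sum_le_card_nsmul _ _ 1 fun i _ => ?_).trans (by simp)
  exact entry_norm_bound_of_unitary U.2 i i

/-- For unitary $V\ne1$ of size $n$, $2n-2\,\mathrm{Re}\,\mathrm{tr}\,V=\mathrm{tr}\,(V-1)^*(V-1)$
is the sum of the squared moduli of the entries of $V-1$, hence positive. -/
theorem re_trace_lt {ι : Type*} [Fintype ι] [DecidableEq ι] (U : Matrix.unitaryGroup ι ℂ)
    (hU : U ≠ 1) : (U : Matrix ι ι ℂ).trace.re < Fintype.card ι := by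
  obtain ⟨V, hV⟩ := U
  change V.trace.re < _
  have hVV : Vᴴ * V = 1 := Matrix.mem_unitaryGroup_iff'.1 hV
  have hne : V - 1 ≠ 0 := fun h => hU (Subtype.ext (sub_eq_zero.1 h))
  have hexp : (V - 1)ᴴ * (V - 1) = 1 - Vᴴ - V + 1 := by
    rw [Matrix.conjTranspose_sub, Matrix.conjTranspose_one, sub_mul, mul_sub, mul_sub, hVV]
    simp only [mul_one, one_mul]
    abel
  have htr : ((V - 1)ᴴ * (V - 1)).trace = ∑ i, ∑ j, ((‖(V - 1) j i‖ ^ 2 : ℝ) : ℂ) := by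
    simp only [Matrix.trace, Matrix.diag_apply, Matrix.mul_apply, Matrix.conjTranspose_apply]
    refine Finset.sum_congr rfl fun i _ => Finset.sum_congr rfl fun j _ => ?_
    rw [← starRingEnd_apply, Complex.conj_mul']
    push_cast
    rfl
  have hpos : 0 < ∑ i, ∑ j, ‖(V - 1) j i‖ ^ 2 := by
    refine lt_of_le_of_ne (by positivity) fun h => hne ?_
    rw [eq_comm, Finset.sum_eq_zero_iff_of_nonneg (fun i _ => by positivity)] at h
    ext j i
    have h1 := h i (Finset.mem_univ _)
    rw [Finset.sum_eq_zero_iff_of_nonneg (fun i _ => by positivity)] at h1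
    simpa using h1 j (Finset.mem_univ _)
  rw [hexp] at htr
  have hre := congrArg Complex.re htr
  simp only [Matrix.trace_add, Matrix.trace_sub, Matrix.trace_one, Matrix.trace_conjTranspose,
    Complex.add_re, Complex.sub_re, Complex.natCast_re, ← Complex.ofReal_sum,
    Complex.ofReal_re, Complex.star_def, Complex.conj_re] at hre
  linarith

theorem norm_char_le_one (σ : MatrixRep G) (g : G) : ‖σ.char g‖ ≤ 1 := by
  rw [char, norm_div, Complex.norm_natCast, div_le_one σ.card_pos]
  exact norm_trace_le _

/-- The trivial one-dimensional representation. -/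
def trivial (G : Type*) [Group G] : MatrixRep G where
  ι := Unit
  π := 1

/-- The tensor product of two representations. -/
def tensor (σ τ : MatrixRep G) : MatrixRep G where
  ι := σ.ι × τ.ι
  π :=
    { toFun := fun g => ⟨(σ.π g : Matrix σ.ι σ.ι ℂ) ⊗ₖ (τ.π g : Matrix τ.ι τ.ι ℂ),
        Matrix.kronecker_mem_unitary (σ.π g).2 (τ.π g).2⟩
      map_one' := Subtype.ext (by simp)
      map_mul' := fun g h => Subtype.ext (by simp [Matrix.mul_kronecker_mul]) }

theorem char_tensor (σ τ : MatrixRep G) (g : G) :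
    (σ.tensor τ).char g = σ.char g * τ.char g := by
  have h : ((σ.tensor τ).π g).1.trace
      = (σ.π g : Matrix σ.ι σ.ι ℂ).trace * (τ.π g : Matrix τ.ι τ.ι ℂ).trace :=
    Matrix.trace_kronecker _ _
  have hc : Fintype.card (σ.tensor τ).ι = Fintype.card σ.ι * Fintype.card τ.ι :=
    Fintype.card_prod _ _
  rw [char, hc, char, char, div_mul_div_comm]
  push_cast
  exact congrArg (· / _) h

/-- The direct sum of a matrix representation and the trivial one. -/
def addTrivial {n : ℕ} (π : G →* Matrix.unitaryGroup (Fin n) ℂ) : MatrixRep G where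
  ι := Fin n ⊕ Unit
  π :=
    { toFun := fun g => ⟨Matrix.fromBlocks (π g : Matrix (Fin n) (Fin n) ℂ) 0 0 1, by
        have h : (π g : Matrix (Fin n) (Fin n) ℂ) * (π g : Matrix (Fin n) (Fin n) ℂ)ᴴ = 1 :=
          Matrix.mem_unitaryGroup_iff.1 (π g).2
        rw [Matrix.mem_unitaryGroup_iff, Matrix.star_eq_conjTranspose,
          Matrix.fromBlocks_conjTranspose, Matrix.fromBlocks_multiply]
        simp [h]⟩
      map_one' := by ext1; simp
      map_mul' := fun g h => by ext1; simp [Matrix.fromBlocks_multiply] }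

/-- The trivial summand is needed because a scalar $\pi(g)\ne1$ has a character of modulus 1. With
$z=\mathrm{tr}\,\pi(g)$, $|z|\le n$ and $\mathrm{Re}\,z<n$ give $|z+1|<n+1$. -/
theorem norm_char_addTrivial_lt_one {n : ℕ} (π : G →* Matrix.unitaryGroup (Fin n) ℂ) {g : G}
    (hg : π g ≠ 1) : ‖(addTrivial π).char g‖ < 1 := by
  have h : ((addTrivial π).π g).1.trace
      = (π g : Matrix (Fin n) (Fin n) ℂ).trace + 1 :=
    by
    change ∑ i : Fin n ⊕ Unit, Matrix.fromBlocks (π g : Matrix (Fin n) (Fin n) ℂ) 0 0 1 i i = _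
    simp [Fintype.sum_sum_type, Matrix.trace]
  have hc : Fintype.card (addTrivial π).ι = n + 1 := by
    change Fintype.card (Fin n ⊕ Unit) = n + 1
    simp
  have h1 := norm_trace_le (π g)
  have h2 := re_trace_lt (π g) hg
  rw [Fintype.card_fin] at h1 h2
  rw [char, norm_div, Complex.norm_natCast, div_lt_one (addTrivial π).card_pos, hc]
  refine (congrArg norm h).trans_lt ?_
  set z := (π g : Matrix (Fin n) (Fin n) ℂ).trace
  have h3 : ‖z + 1‖ ^ 2 = ‖z‖ ^ 2 + 2 * z.re + 1 := by
    rw [Complex.sq_norm, Complex.sq_norm, Complex.normSq_apply, Complex.normSq_apply]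
    simp
    ring
  push_cast
  refine lt_of_pow_lt_pow_left₀ 2 (by positivity) ?_
  have h4 : ‖z‖ ^ 2 ≤ (n : ℝ) ^ 2 := by gcongr
  nlinarith

theorem exists_char_eq_pow (σ : MatrixRep G) (N : ℕ) :
    ∃ τ : MatrixRep G, ∀ g, τ.char g = σ.char g ^ N := by
  induction N with
  | zero => exact ⟨trivial G, fun g => by
    rw [show (trivial G).char g = (trivial G).char 1 from rfl, char_one, pow_zero]⟩
  | succ N ih =>
    obtain ⟨τ, hτ⟩ := ih
    exact ⟨τ.tensor σ, fun g => by rw [char_tensor, hτ, pow_succ]⟩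

theorem exists_norm_char_lt_one (hmap : IsMaximallyAlmostPeriodic G) (S : Finset G)
    (hS : 1 ∉ S) : ∃ σ : MatrixRep G, ∀ g ∈ S, ‖σ.char g‖ < 1 := by
  classical
  induction S using Finset.induction_on with
  | empty => exact ⟨trivial G, by simp⟩
  | insert a S ha ih =>
    obtain ⟨σ, hσ⟩ := ih fun h => hS (Finset.mem_insert_of_mem h)
    obtain ⟨n, π, hπ⟩ := hmap a 1 fun h => hS (h ▸ Finset.mem_insert_self a S)
    rw [map_one] at hπ
    refine ⟨σ.tensor (addTrivial π), fun g hg => ?_⟩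
    rw [char_tensor, norm_mul]
    rcases Finset.mem_insert.1 hg with rfl | hg
    · exact mul_lt_one_of_nonneg_of_lt_one_right (σ.norm_char_le_one _) (norm_nonneg _)
        (norm_char_addTrivial_lt_one π hπ)
    · exact mul_lt_one_of_nonneg_of_lt_one_left (norm_nonneg _) (hσ g hg)
        ((addTrivial π).norm_char_le_one _)

theorem exists_norm_char_lt (hmap : IsMaximallyAlmostPeriodic G) (S : Finset G)
    (hS : 1 ∉ S) {ε : ℝ} (hε : 0 < ε) : ∃ σ : MatrixRep G, ∀ g ∈ S, ‖σ.char g‖ < ε := by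
  obtain ⟨σ, hσ⟩ := exists_norm_char_lt_one hmap S hS
  have h : ∀ᶠ N : ℕ in atTop, ∀ g ∈ S, ‖σ.char g‖ ^ N < ε :=
    (Finset.eventually_all S).2 fun g hg =>
      (tendsto_pow_atTop_nhds_zero_of_lt_one (norm_nonneg _) (hσ g hg)).eventually_lt_const hε
  obtain ⟨N, hN⟩ := h.exists
  obtain ⟨τ, hτ⟩ := σ.exists_char_eq_pow N
  exact ⟨τ, fun g hg => by rw [hτ, norm_pow]; exact hN g hg⟩

/-- On a countable maximally almost periodic group the normalized trace is a pointwise limit of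
normalized characters. -/
theorem exists_seq_tendsto_char [Countable G] (hmap : IsMaximallyAlmostPeriodic G) :
    ∃ σ : ℕ → MatrixRep G, ∀ g, g ≠ 1 → Tendsto (fun k => (σ k).char g) atTop (𝓝 0) := by
  classical
  obtain ⟨f, hf⟩ := exists_surjective_nat G
  -- The bound $1/(k+1)$ is imposed on the first $k+1$ enumerated elements, so each $g\ne1$ is
  -- controlled from its own index on.
  have h (k : ℕ) := exists_norm_char_lt hmap (((Finset.range (k + 1)).image f).erase 1)
    (Finset.notMem_erase _ _) (Nat.one_div_pos_of_nat (α := ℝ) (n := k))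
  choose σ hσ using h
  refine ⟨σ, fun g hg => ?_⟩
  obtain ⟨m, rfl⟩ := hf g
  refine squeeze_zero_norm' ?_ tendsto_one_div_add_atTop_nhds_zero_nat
  filter_upwards [eventually_ge_atTop m] with k hk
  exact (hσ k _ (Finset.mem_erase.2 ⟨hg, Finset.mem_image_of_mem f
    (Finset.mem_range.2 (Nat.lt_succ_of_le hk))⟩)).le

end MatrixRep

end Characters

/-! ### Gram matrix estimates and weak containment. -/

section WeakContainment

open scoped InnerProductSpace ComplexConjugate

theorem inner_self_eq_ofReal_norm_sq {E : Type*} [NormedAddCommGroup E] [InnerProductSpace ℂ E]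
    (x : E) : ⟪x, x⟫_ℂ = ((‖x‖ ^ 2 : ℝ) : ℂ) := by
  rw [inner_self_eq_norm_sq_to_K (𝕜 := ℂ)]
  push_cast
  rfl

section Gram

variable {ι E H : Type*} [NormedAddCommGroup E] [InnerProductSpace ℂ E]
  [NormedAddCommGroup H] [InnerProductSpace ℂ H]

/-- The squared norm of `∑ vₛ ⊗ ηₛ` in terms of a factorization of the Gram matrix of `η`. -/
theorem exists_sum_inner_mul_inner_eq (F : Finset ι) (η : ι → H) :
    ∃ (m : ℕ) (b : Fin m → ι → ℂ), ∀ v : ι → E,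
      ∑ s ∈ F, ∑ t ∈ F, ⟪v s, v t⟫_ℂ * ⟪η s, η t⟫_ℂ
        = ((∑ i, ‖∑ s ∈ F, b i s • v s‖ ^ 2 : ℝ) : ℂ) := by
  classical
  obtain ⟨m, w, hw⟩ := Matrix.posSemidef_iff_eq_sum_vecMulVec.1
    (Matrix.posSemidef_gram ℂ fun s : F => η s)
  refine ⟨m, fun i s => if h : s ∈ F then conj (w i ⟨s, h⟩) else 0, fun v => ?_⟩
  set b : Fin m → ι → ℂ := fun i s => if h : s ∈ F then conj (w i ⟨s, h⟩) else 0 with hb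
  have hG : ∀ s ∈ F, ∀ t ∈ F, ⟪η s, η t⟫_ℂ = ∑ i, conj (b i s) * b i t := fun s hs t ht => by
    have := congrFun (congrFun hw ⟨s, hs⟩) ⟨t, ht⟩
    simpa [Matrix.sum_apply, Matrix.vecMulVec_apply, hb, hs, ht] using this
  rw [Complex.ofReal_sum]
  simp_rw [← inner_self_eq_ofReal_norm_sq, sum_inner, inner_sum, inner_smul_left, inner_smul_right]
  rw [eq_comm, Finset.sum_comm]
  refine Finset.sum_congr rfl fun s hs => ?_
  rw [Finset.sum_comm]
  refine Finset.sum_congr rfl fun t ht => ?_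
  rw [hG s hs t ht, Finset.mul_sum]
  exact Finset.sum_congr rfl fun i _ => by ring

/-- This is $\|(T\otimes1)x\|^2\le C^2\|x\|^2$ for $x=\sum v_s\otimes\eta_s$. Factoring the Gram
matrix of $\eta$ avoids the Hilbert tensor product. -/
theorem re_sum_inner_map_mul_inner_le (F : Finset ι) (η : ι → H) (T : E →L[ℂ] E) {C : ℝ}
    (hT : ‖T‖ ≤ C) (v : ι → E) :
    (∑ s ∈ F, ∑ t ∈ F, ⟪T (v s), T (v t)⟫_ℂ * ⟪η s, η t⟫_ℂ).re
      ≤ C ^ 2 * (∑ s ∈ F, ∑ t ∈ F, ⟪v s, v t⟫_ℂ * ⟪η s, η t⟫_ℂ).re := by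
  obtain ⟨m, b, hb⟩ := exists_sum_inner_mul_inner_eq (E := E) F η
  rw [hb v, hb fun s => T (v s), Complex.ofReal_re, Complex.ofReal_re, Finset.mul_sum]
  refine Finset.sum_le_sum fun i _ => ?_
  simp_rw [← map_smul, ← map_sum]
  rw [← mul_pow]
  exact pow_le_pow_left₀ (norm_nonneg _) (T.le_of_opNorm_le hT _) 2

end Gram

namespace MatrixRep

variable {G : Type*} [Group G]

/-- The operators of a matrix representation on Euclidean space. -/
noncomputable def op (σ : MatrixRep G) :
    G →* unitary (EuclideanSpace ℂ σ.ι →L[ℂ] EuclideanSpace ℂ σ.ι) where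
  toFun g := ⟨Matrix.toEuclideanCLM (n := σ.ι) (𝕜 := ℂ) (σ.π g), Unitary.map_mem _ (σ.π g).2⟩
  map_one' := Subtype.ext (by simp)
  map_mul' g h := Subtype.ext (by simp)

theorem sum_inner_op (σ : MatrixRep G) (g : G) :
    ∑ j, ⟪EuclideanSpace.single j (1 : ℂ),
        (σ.op g).1 (EuclideanSpace.single j (1 : ℂ))⟫_ℂ
      = Fintype.card σ.ι * σ.char g := by
  rw [char, mul_div_cancel₀ _ (Nat.cast_ne_zero.2 Fintype.card_ne_zero)]
  refine Finset.sum_congr rfl fun j _ => ?_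
  simp [op, EuclideanSpace.inner_single_left]

end MatrixRep

theorem inner_unitary_map {G H : Type*} [Group G] [NormedAddCommGroup H] [InnerProductSpace ℂ H]
    [CompleteSpace H] (ρ : G →* unitary (H →L[ℂ] H)) (g h : G) (x y : H) :
    ⟪(ρ g : H →L[ℂ] H) x, (ρ h : H →L[ℂ] H) y⟫_ℂ
      = ⟪x, (ρ (g⁻¹ * h) : H →L[ℂ] H) y⟫_ℂ := by
  rw [map_mul, map_inv, ← Unitary.star_eq_inv]
  simp [ContinuousLinearMap.star_eq_adjoint, ContinuousLinearMap.adjoint_inner_right]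

theorem norm_sum_smul_sq {G H : Type*} [Group G] [NormedAddCommGroup H] [InnerProductSpace ℂ H]
    [CompleteSpace H] (ρ : G →* unitary (H →L[ℂ] H)) (A : Finset G) (c : G → ℂ) (ξ : H) :
    ((‖(∑ a ∈ A, c a • (ρ a : H →L[ℂ] H)) ξ‖ ^ 2 : ℝ) : ℂ)
      = ∑ a ∈ A, ∑ b ∈ A, conj (c a) * c b * ⟪ξ, (ρ (a⁻¹ * b) : H →L[ℂ] H) ξ⟫_ℂ := by
  rw [← inner_self_eq_ofReal_norm_sq]
  simp only [sum_apply, smul_apply, sum_inner, inner_sum,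
    inner_smul_left, inner_smul_right, inner_unitary_map]
  rw [Finset.sum_comm]
  simp only [Finset.mul_sum, mul_assoc, mul_left_comm]

namespace MatrixRep

variable {G : Type*} [Group G]

/-- The Gram estimate summed over an orthonormal basis: matrix coefficients add up to traces, and
the dimension cancels. -/
theorem re_sum_char_mul_inner_le {H : Type*} [NormedAddCommGroup H] [InnerProductSpace ℂ H]
    (σ : MatrixRep G) (A F : Finset G) (c : G → ℂ) (η : G → H) {C : ℝ}
    (hC : ‖∑ a ∈ A, c a • (σ.op a).1‖ ≤ C) :
    (∑ s ∈ F, ∑ t ∈ F, (∑ a ∈ A, ∑ b ∈ A, conj (c a) * c b * σ.char (s * a⁻¹ * (b * t⁻¹)))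
        * ⟪η s, η t⟫_ℂ).re
      ≤ C ^ 2 * (∑ s ∈ F, ∑ t ∈ F, σ.char (s * t⁻¹) * ⟪η s, η t⟫_ℂ).re := by
  set e : σ.ι → EuclideanSpace ℂ σ.ι := fun j => EuclideanSpace.single j (1 : ℂ) with he
  set d : ℝ := ((Fintype.card σ.ι : ℕ) : ℝ) with hd
  have hd0 : 0 < d := σ.card_pos
  have htr (g : G) : ∑ j, ⟪e j, (σ.op g).1 (e j)⟫_ℂ = (d : ℂ) * σ.char g := by
    rw [hd, Complex.ofReal_natCast]
    exact σ.sum_inner_op g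
  -- The inverse makes the coefficients characters of $sa^{-1}bt^{-1}$, which is trivial exactly
  -- when $t=sa^{-1}b$: a right translate of $s$, as right Følner sets require.
  have key (j : σ.ι) := re_sum_inner_map_mul_inner_le F η _ hC fun t => (σ.op t⁻¹).1 (e j)
  have hsum := Finset.sum_le_sum fun j (_ : j ∈ Finset.univ) => key j
  rw [← Finset.mul_sum, ← Complex.re_sum, ← Complex.re_sum] at hsum
  have hR : ∑ j, ∑ s ∈ F, ∑ t ∈ F, ⟪(σ.op s⁻¹).1 (e j), (σ.op t⁻¹).1 (e j)⟫_ℂ * ⟪η s, η t⟫_ℂ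
      = d * ∑ s ∈ F, ∑ t ∈ F, σ.char (s * t⁻¹) * ⟪η s, η t⟫_ℂ := by
    simp_rw [inner_unitary_map, inv_inv]
    rw [Finset.sum_comm, Finset.mul_sum]
    refine Finset.sum_congr rfl fun s _ => ?_
    rw [Finset.sum_comm, Finset.mul_sum]
    refine Finset.sum_congr rfl fun t _ => ?_
    rw [← Finset.sum_mul, htr, mul_assoc]
  have hL : ∑ j, ∑ s ∈ F, ∑ t ∈ F, ⟪(∑ a ∈ A, c a • (σ.op a).1) ((σ.op s⁻¹).1 (e j)),
        (∑ a ∈ A, c a • (σ.op a).1) ((σ.op t⁻¹).1 (e j))⟫_ℂ * ⟪η s, η t⟫_ℂ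
      = d * ∑ s ∈ F, ∑ t ∈ F, (∑ a ∈ A, ∑ b ∈ A,
        conj (c a) * c b * σ.char (s * a⁻¹ * (b * t⁻¹))) * ⟪η s, η t⟫_ℂ := by
    have h1 (a s : G) (x : EuclideanSpace ℂ σ.ι) :
        (σ.op a).1 ((σ.op s⁻¹).1 x) = (σ.op (a * s⁻¹)).1 x :=
      congrArg (fun u => u.1 x) (σ.op.map_mul a s⁻¹).symm
    rw [Finset.sum_comm, Finset.mul_sum]
    refine Finset.sum_congr rfl fun s _ => ?_
    rw [Finset.sum_comm, Finset.mul_sum]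
    refine Finset.sum_congr rfl fun t _ => ?_
    rw [← Finset.sum_mul, ← mul_assoc]
    congr 1
    simp only [sum_apply, smul_apply, h1, sum_inner, inner_sum, inner_smul_left,
      inner_smul_right, inner_unitary_map]
    simp only [Finset.mul_sum]
    rw [Finset.sum_comm]
    conv_rhs => rw [Finset.sum_comm]
    refine Finset.sum_congr rfl fun b _ => ?_
    rw [Finset.sum_comm]
    refine Finset.sum_congr rfl fun a _ => ?_
    simp_rw [← Finset.mul_sum, htr, mul_inv_rev, inv_inv]
    ring
  rw [hL, hR, Complex.re_ofReal_mul, Complex.re_ofReal_mul, mul_left_comm] at hsum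
  exact le_of_mul_le_mul_left hsum hd0

end MatrixRep

/-! ### Følner averaging. -/

section Amenable

variable {G : Type*} [Group G]

open scoped Classical in
-- Right translation by $g$ injects the $s\in F_n$ with $sg\notin F_n$ into the symmetric
-- difference, so the exceptional fraction tends to 0.
theorem tendsto_card_filter_mul_mem_div_card {F : ℕ → Finset G} (h1 : ∀ n, 1 ∈ F n) {g : G}
    (hF : Tendsto (fun n => ((symmDiff (F n) ((F n).image (fun x => x * g))).card : ℝ) /
      ((F n).card : ℝ)) atTop (𝓝 0)) :
    Tendsto (fun n => (((F n).filter fun s => s * g ∈ F n).card : ℝ) / (F n).card)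
      atTop (𝓝 1) := by
  have hpos (n : ℕ) : (0 : ℝ) < (F n).card := Nat.cast_pos.2 (Finset.card_pos.2 ⟨1, h1 n⟩)
  have hlow := hF.const_sub 1
  rw [sub_zero] at hlow
  refine tendsto_of_tendsto_of_tendsto_of_le_of_le hlow tendsto_const_nhds
    (fun n => ?_) fun n => ?_
  · change 1 - _ / _ ≤ _
    rw [one_sub_div (hpos n).ne']
    gcongr
    have hsub : ((F n).filter fun s => s * g ∉ F n).image (fun x => x * g)
        ⊆ symmDiff (F n) ((F n).image (fun x => x * g)) := by
      intro x hx
      obtain ⟨s, hs, rfl⟩ := Finset.mem_image.1 hx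
      rw [Finset.mem_filter] at hs
      exact Finset.mem_symmDiff.2 (Or.inr ⟨Finset.mem_image_of_mem _ hs.1, hs.2⟩)
    have hcard := Finset.card_le_card hsub
    rw [Finset.card_image_of_injective _ (mul_left_injective g)] at hcard
    have hadd := Finset.card_filter_add_card_filter_not (s := F n) fun s => s * g ∈ F n
    rw [sub_le_iff_le_add, ← Nat.cast_add, Nat.cast_le, ← hadd]
    exact Nat.add_le_add_left hcard _
  · rw [div_le_one (hpos n)]
    exact_mod_cast Finset.card_filter_le _ _

variable {H : Type*} [NormedAddCommGroup H] [InnerProductSpace ℂ H] [CompleteSpace H]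

open scoped Classical in
theorem sum_ite_mul_inner_eq (ρ : G →* unitary (H →L[ℂ] H)) (F : Finset G) (a b : G) (ξ : H) :
    ∑ s ∈ F, ∑ t ∈ F, (if s * a⁻¹ * (b * t⁻¹) = 1 then (1 : ℂ) else 0) *
        ⟪(ρ s : H →L[ℂ] H) ξ, (ρ t : H →L[ℂ] H) ξ⟫_ℂ
      = (F.filter fun s => s * (a⁻¹ * b) ∈ F).card
        * ⟪ξ, (ρ (a⁻¹ * b) : H →L[ℂ] H) ξ⟫_ℂ := by
  have h (s t : G) : s * a⁻¹ * (b * t⁻¹) = 1 ↔ s * (a⁻¹ * b) = t := by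
    rw [← mul_assoc, mul_inv_eq_one, mul_assoc]
  simp_rw [h, ite_mul, zero_mul, one_mul, Finset.sum_ite_eq, inner_unitary_map,
    inv_mul_cancel_left]
  rw [← Finset.sum_filter, Finset.sum_const, nsmul_eq_mul]

open scoped Classical in
/-- The estimate behind the weak containment of the regular representation in any family of
finite-dimensional representations whose normalized characters converge to the trace. -/
theorem re_sum_card_filter_mul_inner_le {σ : ℕ → MatrixRep G}
    (hσ : ∀ g, g ≠ 1 → Tendsto (fun k => (σ k).char g) atTop (𝓝 0))
    (ρ : G →* unitary (H →L[ℂ] H)) (A F : Finset G) (c : G → ℂ) {C : ℝ}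
    (hC : ∀ k, ‖∑ a ∈ A, c a • ((σ k).op a).1‖ ≤ C) (ξ : H) :
    (∑ a ∈ A, ∑ b ∈ A, conj (c a) * c b * (((F.filter fun s => s * (a⁻¹ * b) ∈ F).card : ℂ)
      * ⟪ξ, (ρ (a⁻¹ * b) : H →L[ℂ] H) ξ⟫_ℂ)).re ≤ C ^ 2 * (F.card * ‖ξ‖ ^ 2) := by
  have hlim (g : G) :
      Tendsto (fun k => (σ k).char g) atTop (𝓝 (if g = 1 then 1 else 0)) := by
    split_ifs with hg
    · simp only [hg, MatrixRep.char_one, tendsto_const_nhds]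
    · exact hσ g hg
  have hle := le_of_tendsto_of_tendsto'
    ((Complex.continuous_re.tendsto _).comp (tendsto_finsetSum F fun s _ =>
      tendsto_finsetSum F fun t _ => (tendsto_finsetSum A fun a _ =>
      tendsto_finsetSum A fun b _ => (hlim (s * a⁻¹ * (b * t⁻¹))).const_mul
        (conj (c a) * c b)).mul_const ⟪(ρ s : H →L[ℂ] H) ξ, (ρ t : H →L[ℂ] H) ξ⟫_ℂ))
    (((Complex.continuous_re.tendsto _).comp (tendsto_finsetSum F fun s _ =>
      tendsto_finsetSum F fun t _ => (hlim (s * t⁻¹)).mul_const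
        ⟪(ρ s : H →L[ℂ] H) ξ, (ρ t : H →L[ℂ] H) ξ⟫_ℂ)).const_mul (C ^ 2))
    fun k => (σ k).re_sum_char_mul_inner_le A F c (fun s => (ρ s : H →L[ℂ] H) ξ) (hC k)
  convert! hle using 2
  · simp_rw [← sum_ite_mul_inner_eq, Finset.sum_mul, Finset.mul_sum]
    rw [Finset.sum_congr rfl fun a _ => Finset.sum_comm, Finset.sum_comm]
    refine Finset.sum_congr rfl fun s _ => ?_
    rw [Finset.sum_congr rfl fun a _ => Finset.sum_comm, Finset.sum_comm]
    simp only [mul_assoc]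
  -- The right-hand side is the case $a=b=1$, where every $s\in F$ counts.
  · have := sum_ite_mul_inner_eq ρ F 1 1 ξ
    simp only [inv_one, mul_one, one_mul, map_one, Finset.filter_mem_eq_inter,
      Finset.inter_self] at this
    rw [this, OneMemClass.coe_one, one_apply_eq_self, inner_self_eq_ofReal_norm_sq]
    norm_cast

/-- For an amenable group, a sequence of finite-dimensional representations whose normalized
characters converge to the canonical trace weakly contains every unitary representation. -/
theorem norm_sum_smul_le_of_tendsto_char (hamen : IsAmenableGroup G) {σ : ℕ → MatrixRep G}
    (hσ : ∀ g, g ≠ 1 → Tendsto (fun k => (σ k).char g) atTop (𝓝 0))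
    (ρ : G →* unitary (H →L[ℂ] H)) (A : Finset G) (c : G → ℂ) {C : ℝ}
    (hC : ∀ k, ‖∑ a ∈ A, c a • ((σ k).op a).1‖ ≤ C) :
    ‖∑ a ∈ A, c a • (ρ a : H →L[ℂ] H)‖ ≤ C := by
  classical
  obtain ⟨F, h1, hmono, -, hF⟩ := hamen
  have hC0 : 0 ≤ C := (norm_nonneg _).trans (hC 0)
  have h1F (n : ℕ) : 1 ∈ F n := hmono (Nat.zero_le n) h1
  refine ContinuousLinearMap.opNorm_le_bound _ hC0 fun ξ => ?_
  refine le_of_pow_le_pow_left₀ two_ne_zero (by positivity) ?_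
  rw [mul_pow]
  -- The Følner weights tend to 1, so the weighted sums tend to the expansion of $\|\sum
  -- c_a\rho(a)\xi\|^2$.
  have hlim := (Complex.continuous_re.tendsto _).comp (tendsto_finsetSum A fun a _ =>
    tendsto_finsetSum A fun b _ => ((((Complex.continuous_ofReal.tendsto _).comp
      (tendsto_card_filter_mul_mem_div_card h1F (hF (a⁻¹ * b))))).mul_const
        ⟪ξ, (ρ (a⁻¹ * b) : H →L[ℂ] H) ξ⟫_ℂ).const_mul (conj (c a) * c b))
  simp only [Complex.ofReal_one, one_mul, ← norm_sum_smul_sq, Complex.ofReal_re] at hlim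
  refine le_of_tendsto' hlim fun n => ?_
  have hpos : (0 : ℝ) < (F n).card := Nat.cast_pos.2 (Finset.card_pos.2 ⟨1, h1F n⟩)
  have hle := re_sum_card_filter_mul_inner_le hσ ρ A (F n) c hC ξ
  refine le_of_mul_le_mul_left ?_ hpos
  rw [mul_left_comm]
  refine le_trans (le_of_eq ?_) hle
  simp only [Function.comp_apply]
  rw [← Complex.re_ofReal_mul]
  congr 1
  simp only [Finset.mul_sum]
  refine Finset.sum_congr rfl fun a _ => Finset.sum_congr rfl fun b _ => ?_
  have : ((F n).card : ℂ) ≠ 0 := by exact_mod_cast hpos.ne'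
  push_cast
  field_simp

end Amenable

end WeakContainment

/-! ### Block diagonal operators on a Hilbert sum. -/

section BlockDiagonal

open scoped InnerProductSpace

variable {ι : Type*} {E : ι → Type*} [∀ i, NormedAddCommGroup (E i)]
  [∀ i, InnerProductSpace ℂ (E i)]

/-- The block diagonal operator on the Hilbert sum given by a bounded family of operators. -/
noncomputable def blockDiagonal (T : lp (fun i => E i →L[ℂ] E i) ∞) : lp E 2 →L[ℂ] lp E 2 :=
  lp.mapCLM 2 (fun i => T i) (norm_nonneg T) (lp.norm_apply_le_norm ENNReal.top_ne_zero T)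

@[simp]
theorem blockDiagonal_apply (T : lp (fun i => E i →L[ℂ] E i) ∞) (f : lp E 2) (i : ι) :
    blockDiagonal T f i = T i (f i) :=
  rfl

theorem norm_blockDiagonal_le (T : lp (fun i => E i →L[ℂ] E i) ∞) : ‖blockDiagonal T‖ ≤ ‖T‖ :=
  lp.norm_mapCLM_le 2 _ _ _

theorem norm_apply_le_norm_blockDiagonal (T : lp (fun i => E i →L[ℂ] E i) ∞) (i : ι) :
    ‖T i‖ ≤ ‖blockDiagonal T‖ := by
  classical
  refine ContinuousLinearMap.opNorm_le_bound _ (ContinuousLinearMap.opNorm_nonneg _) fun x => ?_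
  have h := (blockDiagonal T).le_opNorm (lp.single 2 i x)
  rw [lp.norm_single two_pos] at h
  have h2 := lp.norm_apply_le_norm two_ne_zero (blockDiagonal T (lp.single 2 i x)) i
  rw [blockDiagonal_apply, lp.single_apply_self] at h2
  exact h2.trans h

variable [∀ i, CompleteSpace (E i)] [∀ i, Nontrivial (E i)]

/-- The representation of bounded families of operators by block diagonal operators. -/
noncomputable def blockDiagonalHom :
    lp (fun i => E i →L[ℂ] E i) ∞ →⋆ₐ[ℂ] (lp E 2 →L[ℂ] lp E 2) where
  toFun := blockDiagonal
  map_one' := by ext f i; simp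
  map_mul' S T := by ext f i; simp
  map_zero' := by ext f i; simp
  map_add' S T := by ext f i; simp
  commutes' c := by
    ext f i
    simp [Algebra.algebraMap_eq_smul_one]
  map_star' T := by
    rw [ContinuousLinearMap.star_eq_adjoint, ContinuousLinearMap.eq_adjoint_iff]
    intro f g
    simp [lp.inner_eq_tsum, ContinuousLinearMap.star_eq_adjoint,
      ContinuousLinearMap.adjoint_inner_left]

end BlockDiagonal

/-! ### Cutoff projections and separability. -/

section Cutoff

variable {E : ℕ → Type*} [∀ i, NormedAddCommGroup (E i)] [∀ i, InnerProductSpace ℂ (E i)]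

section

variable [∀ i, Nontrivial (E i)]

/-- The family consisting of the identity on the first `n` blocks and zero on the others. -/
noncomputable def cutoffFamily (E : ℕ → Type*) [∀ i, NormedAddCommGroup (E i)]
    [∀ i, InnerProductSpace ℂ (E i)] [∀ i, Nontrivial (E i)] (n : ℕ) :
    lp (fun i => E i →L[ℂ] E i) ∞ :=
  ⟨fun i => if i < n then 1 else 0, memℓp_infty ⟨1, by
    rintro _ ⟨i, rfl⟩
    dsimp only
    split_ifs <;> simp⟩⟩

theorem cutoffFamily_apply (n i : ℕ) :
    cutoffFamily E n i = if i < n then 1 else 0 :=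
  rfl

theorem commute_cutoffFamily (T : lp (fun i => E i →L[ℂ] E i) ∞) (n : ℕ) :
    T * cutoffFamily E n = cutoffFamily E n * T := by
  ext i : 2
  simp only [lp.infty_coeFn_mul, Pi.mul_apply, cutoffFamily_apply]
  split_ifs <;> simp

theorem isStarProjection_cutoffFamily [∀ i, CompleteSpace (E i)] (n : ℕ) :
    IsStarProjection (cutoffFamily E n) where
  isIdempotentElem := by
    change _ * _ = _
    ext i : 2
    simp only [lp.infty_coeFn_mul, Pi.mul_apply, cutoffFamily_apply]
    split_ifs <;> simp
  isSelfAdjoint := by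
    change star _ = _
    ext i : 2
    simp only [lp.star_apply, cutoffFamily_apply]
    split_ifs <;> simp

theorem blockDiagonal_cutoffFamily_apply (n : ℕ) (f : lp E 2) :
    blockDiagonal (cutoffFamily E n) f = ∑ k ∈ Finset.range n, lp.single 2 k (f k) := by
  ext i
  rw [blockDiagonal_apply, cutoffFamily_apply, lp.coeFn_sum, Finset.sum_apply]
  simp_rw [lp.single_apply, Finset.sum_pi_single]
  simp only [Finset.mem_range]
  split_ifs <;> rfl

theorem isApproximatingProjections_cutoff [∀ i, FiniteDimensional ℂ (E i)]
    [∀ i, CompleteSpace (E i)] :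
    IsApproximatingProjections fun n => blockDiagonal (cutoffFamily E n) := by
  refine ⟨fun n => (isStarProjection_cutoffFamily n).map blockDiagonalHom, fun n => ?_,
    fun f => ?_⟩
  · have hle : LinearMap.range (blockDiagonal (cutoffFamily E n) : lp E 2 →ₗ[ℂ] lp E 2)
        ≤ ⨆ k : Fin n, LinearMap.range (lp.lsingle (E := E) (𝕜 := ℂ) 2 (k : ℕ)) := by
      rintro _ ⟨f, rfl⟩
      change blockDiagonal (cutoffFamily E n) f ∈ _
      rw [blockDiagonal_cutoffFamily_apply]
      refine Submodule.sum_mem _ fun k hk => ?_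
      exact Submodule.mem_iSup_of_mem (⟨k, Finset.mem_range.1 hk⟩ : Fin n) ⟨f k, rfl⟩
    exact Submodule.finiteDimensional_of_le hle
  · simp only [blockDiagonal_cutoffFamily_apply]
    exact (lp.hasSum_single ENNReal.ofNat_ne_top f).tendsto_sum_nat

end

theorem separableSpace_lp_two [∀ i, FiniteDimensional ℂ (E i)] :
    TopologicalSpace.SeparableSpace (lp E 2) := by
  rw [← TopologicalSpace.isSeparable_univ_iff]
  have hk (k : ℕ) : TopologicalSpace.IsSeparable
      (Set.range (lp.single (E := E) 2 k)) := by
    have : ProperSpace (E k) := FiniteDimensional.proper ℂ (E k)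
    rw [← Set.image_univ]
    exact (TopologicalSpace.IsSeparable.of_separableSpace _).image
      (lp.isometry_single k).continuous
  refine ((TopologicalSpace.IsSeparable.iUnion hk).span (R := ℂ)).closure.mono fun f _ => ?_
  refine mem_closure_of_tendsto (lp.hasSum_single ENNReal.ofNat_ne_top f)
    (Eventually.of_forall fun s => Submodule.sum_mem _ fun k _ => ?_)
  exact Submodule.subset_span (Set.mem_iUnion.2 ⟨k, f k, rfl⟩)

end Cutoff

/-! ### Density of the span of the group in $C^*(G)$. -/

section GroupCStarAlgebra

variable {G : Type u} [Group G]

/-- The image of $G$ is already closed under products and adjoints, so the generated star algebra is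
just its linear span. -/
theorem range_universalRep_eq_closure :
    (Submonoid.closure (Set.range (universalRep G) ∪ star (Set.range (universalRep G))) :
      Set (UniversalOperators G)) = Set.range (universalRep G) := by
  let M : Submonoid (UniversalOperators G) :=
    { carrier := Set.range (universalRep G)
      one_mem' := ⟨1, by ext i : 2; simp [universalRep]⟩
      mul_mem' := by
        rintro _ _ ⟨g, rfl⟩ ⟨h, rfl⟩
        exact ⟨g * h, by ext i : 2; simp [universalRep]⟩ }
  have hstar : star (Set.range (universalRep G)) = Set.range (universalRep G) := by
    have hinv (g : G) : star (universalRep G g) = universalRep G g⁻¹ := by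
      ext i : 2
      simp only [lp.star_apply, universalRep, map_inv, ← Unitary.star_eq_inv, Unitary.coe_star]
    ext x
    refine ⟨fun ⟨g, hg⟩ => ⟨g⁻¹, ?_⟩, ?_⟩
    · rw [← hinv, hg, star_star]
    · rintro ⟨g, rfl⟩
      exact ⟨g⁻¹, (hinv g).symm⟩
  rw [hstar, Set.union_self]
  exact congrArg _ (Submonoid.closure_eq M)

theorem coe_adjoin_universalRep :
    (StarAlgebra.adjoin ℂ (Set.range (universalRep G)) : Set (UniversalOperators G))
      = Submodule.span ℂ (Set.range (universalRep G)) := by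
  conv_rhs => rw [← range_universalRep_eq_closure, ← StarAlgebra.adjoin_eq_span]
  rfl

theorem coe_groupCStarSubalgebra :
    (groupCStarSubalgebra G : Set (UniversalOperators G))
      = closure (Submodule.span ℂ (Set.range (universalRep G))) := by
  rw [← coe_adjoin_universalRep]
  rfl

theorem isSeparable_groupCStarSubalgebra [Countable G] :
    TopologicalSpace.IsSeparable (groupCStarSubalgebra G : Set (UniversalOperators G)) := by
  rw [coe_groupCStarSubalgebra]
  exact (Set.countable_range _).isSeparable.span.closure

end GroupCStarAlgebra

/-! ### Transport of blocks along isometries. -/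

section Conjugation

variable {H K : Type*} [NormedAddCommGroup H] [InnerProductSpace ℂ H] [CompleteSpace H]
  [NormedAddCommGroup K] [InnerProductSpace ℂ K] [CompleteSpace K]

theorem conjStarAlgEquiv_mem_unitary (e : H ≃ₗᵢ[ℂ] K) {U : H →L[ℂ] H}
    (hU : U ∈ unitary (H →L[ℂ] H)) : e.conjStarAlgEquiv U ∈ unitary (K →L[ℂ] K) :=
  Unitary.map_mem _ hU

/-- The conjugate of a unitary representation by an isometry. -/
noncomputable def conjUnitaryHom {G : Type*} [Group G] (e : H ≃ₗᵢ[ℂ] K)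
    (ρ : G →* unitary (H →L[ℂ] H)) : G →* unitary (K →L[ℂ] K) where
  toFun g := ⟨e.conjStarAlgEquiv (ρ g), conjStarAlgEquiv_mem_unitary e (ρ g).2⟩
  map_one' := Subtype.ext (by simp)
  map_mul' g h := Subtype.ext (by simp)

theorem norm_conjStarAlgEquiv_le (e : H ≃ₗᵢ[ℂ] K) (T : H →L[ℂ] H) :
    ‖e.conjStarAlgEquiv T‖ ≤ ‖T‖ := by
  refine ContinuousLinearMap.opNorm_le_bound _ (norm_nonneg _) fun y => ?_
  rw [e.conjStarAlgEquiv_apply_apply, e.norm_map]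
  simpa using T.le_opNorm (e.symm y)

end Conjugation

namespace UnitaryRep

variable {G : Type u} [Group G] {κ : Type*} {E : κ → Type*} [∀ k, NormedAddCommGroup (E k)]
  [∀ k, InnerProductSpace ℂ (E k)] [∀ k, CompleteSpace (E k)] [∀ k, Nontrivial (E k)]

/-- The components of universal operators at a family of unitary representations, transported to
isometric Hilbert spaces. -/
noncomputable def components (i : κ → UnitaryRep G) (e : ∀ k, (i k).H ≃ₗᵢ[ℂ] E k) :
    UniversalOperators G →⋆ₐ[ℂ] lp (fun k => E k →L[ℂ] E k) ∞ where
  toFun T := ⟨fun k => (e k).conjStarAlgEquiv (T (i k)), memℓp_infty ⟨‖T‖, by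
    rintro _ ⟨k, rfl⟩
    exact (norm_conjStarAlgEquiv_le (e k) _).trans
      (lp.norm_apply_le_norm ENNReal.top_ne_zero T _)⟩⟩
  map_one' := by ext k : 2; exact map_one (e k).conjStarAlgEquiv
  map_mul' S T := by ext k : 2; exact map_mul (e k).conjStarAlgEquiv _ _
  map_zero' := by ext k : 2; exact map_zero (e k).conjStarAlgEquiv
  map_add' S T := by ext k : 2; exact map_add (e k).conjStarAlgEquiv _ _
  commutes' c := by
    ext k : 2
    exact AlgHomClass.commutes (e k).conjStarAlgEquiv c
  map_star' T := by ext k : 2; exact map_star (e k).conjStarAlgEquiv _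

theorem norm_components_le (i : κ → UnitaryRep G) (e : ∀ k, (i k).H ≃ₗᵢ[ℂ] E k)
    (T : UniversalOperators G) : ‖components i e T‖ ≤ ‖T‖ :=
  lp.norm_le_of_forall_le (norm_nonneg T) fun k => (norm_conjStarAlgEquiv_le (e k) _).trans
    (lp.norm_apply_le_norm ENNReal.top_ne_zero T _)

end UnitaryRep

/-! ### The faithful sum of matrix representations. -/

namespace MatrixRep

variable {G : Type u} [Group G]

/-- Euclidean space in the universe of the group. -/
noncomputable def uliftIsometry (σ : MatrixRep G) :
    EuclideanSpace ℂ σ.ι ≃ₗᵢ[ℂ] EuclideanSpace ℂ (ULift.{u} σ.ι) :=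
  LinearIsometryEquiv.piLpCongrLeft 2 ℂ ℂ Equiv.ulift.symm

/-- The unitary representation given by a matrix representation. -/
noncomputable def toUnitaryRep (σ : MatrixRep G) : UnitaryRep G where
  H := EuclideanSpace ℂ (ULift.{u} σ.ι)
  ρ := conjUnitaryHom σ.uliftIsometry σ.op

/-- The components of universal operators at a family of matrix representations. -/
noncomputable def components {κ : Type*} (σ : κ → MatrixRep G) :
    UniversalOperators G →⋆ₐ[ℂ]
      lp (fun k => EuclideanSpace ℂ (σ k).ι →L[ℂ] EuclideanSpace ℂ (σ k).ι) ∞ :=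
  UnitaryRep.components (fun k => (σ k).toUnitaryRep) fun k => (σ k).uliftIsometry.symm

theorem components_universalRep {κ : Type*} (σ : κ → MatrixRep G) (g : G) (k : κ) :
    components σ (universalRep G g) k = ((σ k).op g).1 :=
  (σ k).uliftIsometry.conjStarAlgEquiv.symm_apply_apply _

/-- The representation of the universal operators on the Hilbert sum of matrix representations. -/
noncomputable def sumHom {κ : Type*} (σ : κ → MatrixRep G) :
    UniversalOperators G →⋆ₐ[ℂ]
      (lp (fun k => EuclideanSpace ℂ (σ k).ι) 2 →L[ℂ] lp (fun k => EuclideanSpace ℂ (σ k).ι) 2) :=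
  blockDiagonalHom.comp (components σ)

theorem continuous_sumHom {κ : Type*} (σ : κ → MatrixRep G) : Continuous (sumHom σ) := by
  refine AddMonoidHomClass.continuous_of_bound (sumHom σ) 1 fun T => ?_
  rw [one_mul]
  exact (norm_blockDiagonal_le _).trans (UnitaryRep.norm_components_le _ _ T)

/-- The inequality is closed in $T$, so finite sums over $G$ suffice. There each universal component
is bounded by weak containment, with $C$ the norm of the block diagonal image. -/
theorem norm_le_norm_sumHom (hamen : IsAmenableGroup G) {σ : ℕ → MatrixRep G}
    (hσ : ∀ g, g ≠ 1 → Tendsto (fun k => (σ k).char g) atTop (𝓝 0)) {T : UniversalOperators G}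
    (hT : T ∈ groupCStarSubalgebra G) : ‖T‖ ≤ ‖sumHom σ T‖ := by
  classical
  have hT' : T ∈ closure (Submodule.span ℂ (Set.range (universalRep G)) :
      Set (UniversalOperators G)) := coe_groupCStarSubalgebra (G := G) ▸ hT
  refine closure_minimal (t := {T | ‖T‖ ≤ ‖sumHom σ T‖}) (fun x hx => ?_)
    (isClosed_le continuous_norm (continuous_sumHom σ).norm) hT'
  obtain ⟨c, rfl⟩ := Finsupp.mem_span_range_iff_exists_finsupp.1 hx
  refine lp.norm_le_of_forall_le (norm_nonneg _) fun i => ?_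
  have heval : (c.sum fun g a => a • universalRep G g) i
      = ∑ g ∈ c.support, c g • (i.ρ g : i.H →L[ℂ] i.H) := by
    rw [Finsupp.sum, lp.coeFn_sum, Finset.sum_apply]
    rfl
  rw [heval]
  refine norm_sum_smul_le_of_tendsto_char hamen hσ i.ρ c.support c fun k => ?_
  refine le_of_eq_of_le (congrArg norm ?_)
    (norm_apply_le_norm_blockDiagonal (components σ (c.sum fun g a => a • universalRep G g)) k)
  rw [Finsupp.sum, map_sum, lp.coeFn_sum, Finset.sum_apply]
  refine Finset.sum_congr rfl fun g _ => ?_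
  rw [show components σ (c g • universalRep G g) = c g • components σ (universalRep G g) from
    (components σ).toAlgHom.toLinearMap.map_smul _ _, lp.coeFn_smul, Pi.smul_apply, components_universalRep]

end MatrixRep

theorem theorem5 (G : Type u) [Group G] [Countable G]
    (hamen : IsAmenableGroup G) (hmap : IsMaximallyAlmostPeriodic G) :
    IsQuasidiagonalCStarAlgebra (GroupCStarAlgebra G) := by
  obtain ⟨σ, hσ⟩ := MatrixRep.exists_seq_tendsto_char hmap
  let E : ℕ → Type := fun k => EuclideanSpace ℂ (σ k).ι
  refine ⟨lp E 2, inferInstance, inferInstance, inferInstance, separableSpace_lp_two,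
    (MatrixRep.sumHom σ).comp (groupCStarSubalgebra G).subtype, ?_, ?_, ?_⟩
  · rw [injective_iff_map_eq_zero]
    intro x hx
    have h := MatrixRep.norm_le_norm_sumHom hamen hσ x.2
    rw [show MatrixRep.sumHom σ x.1 = 0 from hx, norm_zero, norm_le_zero_iff] at h
    exact Subtype.ext h
  · refine (isSeparable_groupCStarSubalgebra.image (MatrixRep.continuous_sumHom σ)).mono ?_
    rintro _ ⟨x, rfl⟩
    exact ⟨x.1, x.2, rfl⟩
  -- The dense-span subset is the whole image: every commutator with a cutoff vanishes exactly.
  · refine ⟨fun n => blockDiagonal (cutoffFamily E n), isApproximatingProjections_cutoff,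
      _, subset_rfl, Submodule.subset_span.trans subset_closure, ?_⟩
    rintro _ ⟨x, rfl⟩
    refine tendsto_const_nhds.congr fun n => ?_
    have hcomm : MatrixRep.sumHom σ x.1 * blockDiagonal (cutoffFamily E n)
        = blockDiagonal (cutoffFamily E n) * MatrixRep.sumHom σ x.1 := by
      have := congrArg blockDiagonalHom (commute_cutoffFamily (MatrixRep.components σ x.1) n)
      rwa [map_mul, map_mul] at this
    exact (norm_eq_zero.2 (sub_eq_zero.2 hcomm)).symm
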